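/- Let $\mu_1,\mu_2$ be Borel probability measures on the unit sphere $S^2\subset\mathbb{R}^3$ that are nondegenerate, i.e. $\mu_i(Q)=0$ for every great circle $Q\subset S^2$. For each $n\ge 1$ let $D_n$ be a $(\mu_1,\mu_2)$-random geodesic drawing of $K_{n,n}$: its two vertex classes are $a_1,\dots,a_n$ and $b_1,\dots,b_n$, where these $2n$ points of $S^2$ are independent, each $a_i$ has law $\mu_1$ and each $b_j$ has law $\mu_2$, and each edge $a_ib_j$ is drawn as the shortest great-circle arc from $a_i$ to $b_j$ (almost surely unique). All the $D_n$ live on one probability space, with arbitrary dependence between different values of $n$. Let $X_n$ be the crossing graph of $D_n$: its vertices are the $n^2$ edges of $D_n$, and two of them are adjacent if they cross, i.e. have a common interior point. For finite simple graphs $H,G$ let $t(H,G)=\hom(H,G)/|V(G)|^{|V(H)|}$, and for a graphon $W$ (a symmetric measurable function $[0,1]^2\to[0,1]$) let $$t(H,W)=\int_{[0,1]^{V(H)}}\ \prod_{uv\in E(H)}W(x_u,x_v)\,dx.$$ For a graph $H$ with $k$ vertices $1,\dots,k$, let $p_H$ be the probability that, for independent points $a_1,\dots,a_k$ of law $\mu_1$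 and $b_1,\dots,b_k$ of law $\mu_2$, the geodesic segments $a_ib_i$ and $a_jb_j$ intersect for every edge $ij$ of $H$. Then there is a graphon $W=W(\mu_1,\mu_2)$, depending only on $\mu_1$ and $\mu_2$, such that $t(H,W)=p_H$ for every finite graph $H$ and, with probability $1$, the sequence $(X_n)$ is convergent (that is, $t(H)=\lim_{n\to\infty}t(H,X_n)$ exists for every finite graph $H$) and its limit is $W$, i.e. $t(H)=t(H,W)=p_H$ for every finite graph $H$. -/

import Mathlib

open MeasureTheory ProbabilityTheory Filter Topology

/-- The unit sphere `S²` in `ℝ³`, with its Borel σ-algebra. -/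
abbrev Sphere2 : Type := Metric.sphere (0 : EuclideanSpace ℝ (Fin 3)) 1

/-- `μ` is nondegenerate: every great circle (the trace on the sphere of a linear plane)
has measure zero. -/
def Nondegenerate (μ : Measure Sphere2) : Prop :=
  ∀ Q : Submodule ℝ (EuclideanSpace ℝ (Fin 3)), Module.finrank ℝ Q = 2 →
    μ {x : Sphere2 | (x : EuclideanSpace ℝ (Fin 3)) ∈ Q} = 0

/-- The geodesic segment joining `u` and `v`, endpoints included: the points of the sphere in the
convex cone spanned by `u` and `v`. For `v ≠ -u` this is the unique shortest great-circle arc from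
`u` to `v`. For antipodal `u`, `v` the arc is not unique and the value is just `{u, v}`; under
nondegenerate measures this case has probability zero. -/
def geodesicSegment (u v : Sphere2) : Set Sphere2 :=
  {x | ∃ s t : ℝ, 0 ≤ s ∧ 0 ≤ t ∧
    (x : EuclideanSpace ℝ (Fin 3)) =
      s • (u : EuclideanSpace ℝ (Fin 3)) + t • (v : EuclideanSpace ℝ (Fin 3))}

/-- The relative interior of the geodesic segment: the endpoints are removed. -/
def geodesicInterior (u v : Sphere2) : Set Sphere2 :=
  geodesicSegment u v \ {u, v}

/-- The crossing graph of the geodesic drawing of `K_{n,n}` with parts `a` and `b`. Its vertices are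
the `n²` edges of the drawing, `(i, j)` standing for the geodesic segment from `a i` to `b j`, and
two distinct edges are adjacent if they cross, i.e. have a common interior point. -/
def crossingGraph {n : ℕ} (a b : Fin n → Sphere2) : SimpleGraph (Fin n × Fin n) where
  Adj e f := e ≠ f ∧
    (geodesicInterior (a e.1) (b e.2) ∩ geodesicInterior (a f.1) (b f.2)).Nonempty
  symm := ⟨fun _ _ h => ⟨h.1.symm, by rw [Set.inter_comm]; exact h.2⟩⟩
  loopless := ⟨fun _ h => h.1 rfl⟩

/-- The intersection graph of the geodesic segments from `a i` to `b i`, `i ∈ V`. -/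
def segmentIntersectionGraph {V : Type*} (a b : V → Sphere2) : SimpleGraph V where
  Adj i j := i ≠ j ∧ (geodesicSegment (a i) (b i) ∩ geodesicSegment (a j) (b j)).Nonempty
  symm := ⟨fun _ _ h => ⟨h.1.symm, by rw [Set.inter_comm]; exact h.2⟩⟩
  loopless := ⟨fun _ h => h.1 rfl⟩

/-- `p_H`: the probability that, for independent `(μ₁, μ₂)`-random geodesic segments indexed by the
vertices of `H`, every edge of `H` joins two intersecting segments. -/
noncomputable def segmentProb {V : Type*} [Fintype V] (μ₁ μ₂ : Measure Sphere2)
    (H : SimpleGraph V) : ℝ :=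
  ((Measure.pi fun _ : V => μ₁).prod (Measure.pi fun _ : V => μ₂)).real
    {p : (V → Sphere2) × (V → Sphere2) | H ≤ segmentIntersectionGraph p.1 p.2}

/-- The homomorphism density `t(H, G) = hom(H, G) / |G|^|H|`. -/
noncomputable def homDensity {V V' : Type*} (H : SimpleGraph V) (G : SimpleGraph V') : ℝ :=
  (Nat.card (H →g G) : ℝ) / (Nat.card V' : ℝ) ^ Nat.card V

/-- A graphon: a symmetric measurable function `[0,1]² → [0,1]`. -/
structure Graphon where
  toFun : unitInterval → unitInterval → ℝ
  measurable' : Measurable (Function.uncurry toFun)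
  symm' : ∀ x y, toFun x y = toFun y x
  nonneg' : ∀ x y, 0 ≤ toFun x y
  le_one' : ∀ x y, toFun x y ≤ 1

/-- The value of a graphon on an unordered pair. -/
def Graphon.onPair (W : Graphon) : Sym2 unitInterval → ℝ :=
  Sym2.lift ⟨W.toFun, W.symm'⟩

open Classical in
/-- The homomorphism density `t(H, W) = ∫_{[0,1]^V} ∏_{uv ∈ E(H)} W(x_u, x_v) dx`. -/
noncomputable def Graphon.density {V : Type*} [Fintype V] (H : SimpleGraph V) (W : Graphon) : ℝ :=
  ∫ x : V → unitInterval, ∏ e ∈ H.edgeFinset, W.onPair (Sym2.map x e)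

/-- The graph sequence `X` is convergent: `t(H, X n)` converges for every finite graph `H`. -/
def ConvergentGraphSeq {V : ℕ → Type*} (X : ∀ n, SimpleGraph (V n)) : Prop :=
  ∀ (k : ℕ) (H : SimpleGraph (Fin k)), ∃ t : ℝ,
    Tendsto (fun n => homDensity H (X n)) atTop (𝓝 t)

/-- The graphon `W` is the limit of the graph sequence `X`: `t(H, X n) → t(H, W)` for every finite
graph `H`. -/
def IsGraphonLimit {V : ℕ → Type*} (X : ∀ n, SimpleGraph (V n)) (W : Graphon) : Prop :=
  ∀ (k : ℕ) (H : SimpleGraph (Fin k)),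
    Tendsto (fun n => homDensity H (X n)) atTop (𝓝 (W.density H))

/-- For every `n`, the `2n` points `a n i`, `b n j` are independent, the `a n i` with law `μ₁` and
the `b n j` with law `μ₂`. Nothing is assumed about the joint law for different values of `n`. -/
structure IsRandomDrawingSeq {Ω : Type*} [MeasurableSpace Ω] (P : Measure Ω)
    (μ₁ μ₂ : Measure Sphere2) (a b : (n : ℕ) → Fin n → Ω → Sphere2) : Prop where
  law_left : ∀ n i, HasLaw (a n i) μ₁ P
  law_right : ∀ n j, HasLaw (b n j) μ₂ P
  indep : ∀ n, iIndepFun (Sum.elim (a n) (b n)) P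

/-!
The homomorphism density of `H` in the crossing graph of a drawing is a statement about empirical
measures. Let `C` be the set of configurations of segments indexed by the vertices of `H` in which
every edge of `H` joins two crossing arcs (`crossingConfigs`). If the points `a i` are distinct and
the points `b j` are distinct, the density equals the measure of `C` under the product of powers of
the empirical measures of `a` and of `b` (`homDensity_crossingGraph`), since both count maps from
the vertices of `H` to pairs of indices. Almost surely the empirical measures converge weakly to
`μ₁` and `μ₂` (`ae_tendsto_empiricalMeasure`). Nothing is known about the joint law of different
rows, so the law of large numbers needs summable tails; Hoeffding's inequality and the Borel–Cantelli
lemma give them. Products of weakly convergent probability measures converge weakly, and the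
portmanteau theorem then yields convergence of the measures of `C`, provided that the frontier of `C`
is null.

The frontier is null because of nondegeneracy. Almost surely any three of the four endpoints of two
random segments are linearly independent (`ae_generalPosition`), and for such endpoints Cramer's rule
turns crossing into a condition on the signs of four nonvanishing determinants
(`GeneralPosition.crossingSigns`, `CrossingSigns.arcsCross`), which is locally constant. The same
equivalence shows that interiors crossing and closed segments meeting have the same probability, so
the limit is `p_H`.

The graphon is the indicator of the sign condition on the space of segments with the law `μ₁ × μ₂`,
carried to `[0, 1]` by a measurable map from `[0, 1]` with that law; such a map exists because the
space of segments is standard Borel.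
-/

/-! ### Crossing of geodesic arcs in terms of determinants -/

/-- The determinant of three vectors of `ℝ³`. -/
def tripleProduct (x y z : EuclideanSpace ℝ (Fin 3)) : ℝ :=
  x 0 * (y 1 * z 2 - y 2 * z 1) - x 1 * (y 0 * z 2 - y 2 * z 0) + x 2 * (y 0 * z 1 - y 1 * z 0)

/-- The segments `uv` and `u'v'` are in general position: any three of the four endpoints are
linearly independent. -/
def GeneralPosition (u v u' v' : Sphere2) : Prop :=
  tripleProduct v u' v' ≠ 0 ∧ tripleProduct u u' v' ≠ 0 ∧ tripleProduct u v v' ≠ 0 ∧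
    tripleProduct u v u' ≠ 0

/-- The sign pattern of the four determinants of the endpoints which, by Cramer's rule, says that a
positive combination of `u` and `v` equals a positive combination of `u'` and `v'`. -/
def CrossingSigns (u v u' v' : Sphere2) : Prop :=
  tripleProduct v u' v' * tripleProduct u u' v' < 0 ∧
    tripleProduct v u' v' * tripleProduct u v v' < 0 ∧
    tripleProduct u v v' * tripleProduct u v u' < 0

/-- The arcs `uv` and `u'v'` are different and have a common interior point. Asking for
`(u, v) ≠ (u', v')` here is what makes the crossing graph of a drawing with distinct vertices the
pullback of this relation. -/
def ArcsCross (u v u' v' : Sphere2) : Prop :=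
  (u, v) ≠ (u', v') ∧ (geodesicInterior u v ∩ geodesicInterior u' v').Nonempty

theorem Continuous.tripleProduct {X : Type*} [TopologicalSpace X] {x y z : X → Sphere2}
    (hx : Continuous x) (hy : Continuous y) (hz : Continuous z) :
    Continuous fun q => tripleProduct (x q) (y q) (z q) := by
  unfold _root_.tripleProduct
  fun_prop

theorem crossingSigns_symm {u v u' v' : Sphere2} (h : CrossingSigns u v u' v') :
    CrossingSigns u' v' u v := by
  obtain ⟨h1, h2, h3⟩ := h
  have e1 : tripleProduct v' u v = tripleProduct u v v' := by simp only [tripleProduct]; ring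
  have e2 : tripleProduct u' u v = tripleProduct u v u' := by simp only [tripleProduct]; ring
  have e3 : tripleProduct u' v' v = tripleProduct v u' v' := by simp only [tripleProduct]; ring
  have e4 : tripleProduct u' v' u = tripleProduct u u' v' := by simp only [tripleProduct]; ring
  unfold CrossingSigns
  rw [e1, e2, e3, e4]
  exact ⟨h3, by linarith, h1⟩

/-- If positive combinations of `u, v` and of `u', v'` agree, then normalizing the common value
gives a point inside both arcs. -/
theorem geodesicInterior_inter_nonempty {u v u' v' : Sphere2}
    (h1 : tripleProduct v u' v' ≠ 0) (h4 : tripleProduct u v u' ≠ 0)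
    {s t s' t' : ℝ} (hs : 0 < s) (ht : 0 < t) (hs' : 0 < s') (ht' : 0 < t')
    (h : s • (u : EuclideanSpace ℝ (Fin 3)) + t • (v : EuclideanSpace ℝ (Fin 3)) =
      s' • (u' : EuclideanSpace ℝ (Fin 3)) + t' • (v' : EuclideanSpace ℝ (Fin 3))) :
    (geodesicInterior u v ∩ geodesicInterior u' v').Nonempty := by
  set y : EuclideanSpace ℝ (Fin 3) := s • u.1 + t • v.1 with hy
  have hy0 : y ≠ 0 := by
    intro h0
    have : tripleProduct y v u' = s * tripleProduct u v u' := by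
      simp only [hy, tripleProduct, PiLp.add_apply, PiLp.smul_apply, smul_eq_mul]; ring
    rw [h0] at this
    have h00 : tripleProduct 0 v u' = 0 := by simp [tripleProduct]
    rw [h00] at this
    exact mul_ne_zero hs.ne' h4 this.symm
  have hr : 0 < ‖y‖⁻¹ := inv_pos.2 (norm_pos_iff.2 hy0)
  set r := ‖y‖⁻¹
  have hx : r • y ∈ Metric.sphere (0 : EuclideanSpace ℝ (Fin 3)) 1 := by
    rw [mem_sphere_zero_iff_norm, norm_smul, Real.norm_of_nonneg hr.le]
    exact inv_mul_cancel₀ (norm_ne_zero_iff.2 hy0)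
  have e1 : r • y = (r * s) • u.1 + (r * t) • v.1 := by
    rw [hy, smul_add, smul_smul, smul_smul]
  have e2 : r • y = (r * s') • u'.1 + (r * t') • v'.1 := by
    rw [h, smul_add, smul_smul, smul_smul]
  have p1 := mul_pos hr hs
  have p2 := mul_pos hr ht
  have p3 := mul_pos hr hs'
  have p4 := mul_pos hr ht'
  refine ⟨⟨r • y, hx⟩, ⟨⟨_, _, p1.le, p2.le, e1⟩, ?_⟩, ⟨⟨_, _, p3.le, p4.le, e2⟩, ?_⟩⟩
  · rintro (h0 | h0)
    · have h0' : r • y = u.1 := congrArg Subtype.val h0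
      have : tripleProduct u (r • y) u' = (r * t) * tripleProduct u v u' := by
        simp only [e1, tripleProduct, PiLp.add_apply, PiLp.smul_apply, smul_eq_mul]; ring
      rw [h0', show tripleProduct u u u' = 0 by simp only [tripleProduct]; ring] at this
      exact mul_ne_zero p2.ne' h4 this.symm
    · have h0' : r • y = v.1 := congrArg Subtype.val h0
      have : tripleProduct (r • y) v u' = (r * s) * tripleProduct u v u' := by
        simp only [e1, tripleProduct, PiLp.add_apply, PiLp.smul_apply, smul_eq_mul]; ring
      rw [h0', show tripleProduct v v u' = 0 by simp only [tripleProduct]; ring] at this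
      exact mul_ne_zero p1.ne' h4 this.symm
  · rintro (h0 | h0)
    · have h0' : r • y = u'.1 := congrArg Subtype.val h0
      have : tripleProduct v u' (r • y) = (r * t') * tripleProduct v u' v' := by
        simp only [e2, tripleProduct, PiLp.add_apply, PiLp.smul_apply, smul_eq_mul]; ring
      rw [h0', show tripleProduct v u' u' = 0 by simp only [tripleProduct]; ring] at this
      exact mul_ne_zero p4.ne' h1 this.symm
    · have h0' : r • y = v'.1 := congrArg Subtype.val h0
      have : tripleProduct v (r • y) v' = (r * s') * tripleProduct v u' v' := by
        simp only [e2, tripleProduct, PiLp.add_apply, PiLp.smul_apply, smul_eq_mul]; ring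
      rw [h0', show tripleProduct v v' v' = 0 by simp only [tripleProduct]; ring] at this
      exact mul_ne_zero p3.ne' h1 this.symm

theorem CrossingSigns.arcsCross {u v u' v' : Sphere2} (h : CrossingSigns u v u' v') :
    ArcsCross u v u' v' := by
  obtain ⟨h1, h2, h3⟩ := h
  have n1 : tripleProduct v u' v' ≠ 0 := left_ne_zero_of_mul h1.ne
  have n4 : tripleProduct u v u' ≠ 0 := right_ne_zero_of_mul h3.ne
  refine ⟨?_, ?_⟩
  · rintro ⟨⟩
    apply n4
    simp only [tripleProduct]; ring
  -- Cramer's rule: the linear relation among four vectors of `ℝ³`.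
  have cramer : tripleProduct v u' v' • u.1 + (-tripleProduct u u' v') • v.1 =
      (-tripleProduct u v v') • u'.1 + tripleProduct u v u' • v'.1 := by
    ext i
    fin_cases i <;>
    · simp only [tripleProduct, PiLp.add_apply, PiLp.smul_apply, smul_eq_mul, Fin.zero_eta,
        Fin.mk_one, Fin.reduceFinMk]
      ring
  rcases lt_or_gt_of_ne n1 with n | n
  · have p2 := pos_of_mul_neg_right h1 n.le
    have p3 := pos_of_mul_neg_right h2 n.le
    have p4 : tripleProduct u v u' < 0 := neg_of_mul_neg_right h3 p3.le
    refine geodesicInterior_inter_nonempty n1 n4 (neg_pos.2 n) p2 p3 (neg_pos.2 p4) ?_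
    simpa [neg_add_eq_sub, sub_eq_add_neg, add_comm] using congrArg Neg.neg cramer
  · have p2 := neg_of_mul_neg_right h1 n.le
    have p3 := neg_of_mul_neg_right h2 n.le
    have p4 : 0 < tripleProduct u v u' := pos_of_mul_neg_right h3 p3.le
    exact geodesicInterior_inter_nonempty n1 n4 n (neg_pos.2 p2) (neg_pos.2 p3) p4 cramer

/-- If the segments meet, their endpoints satisfy a nontrivial linear relation with signs; pairing it
with cross products of endpoints compares the coefficients with the determinants. -/
theorem GeneralPosition.crossingSigns {u v u' v' : Sphere2} (hg : GeneralPosition u v u' v')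
    (h : (geodesicSegment u v ∩ geodesicSegment u' v').Nonempty) : CrossingSigns u v u' v' := by
  obtain ⟨n1, n2, n3, n4⟩ := hg
  obtain ⟨x, ⟨s, t, hs, ht, e⟩, ⟨s', t', hs', ht', e'⟩⟩ := h
  have hc (i : Fin 3) : s * u.1 i + t * v.1 i = s' * u'.1 i + t' * v'.1 i := by
    simpa using congrArg (fun y : EuclideanSpace ℝ (Fin 3) => y i) (e.symm.trans e')
  have c0 := hc 0
  have c1 := hc 1
  have c2 := hc 2
  have r1 : s * tripleProduct u u' v' + t * tripleProduct v u' v' = 0 := by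
    simp only [tripleProduct]
    linear_combination (u'.1 1 * v'.1 2 - u'.1 2 * v'.1 1) * c0
      - (u'.1 0 * v'.1 2 - u'.1 2 * v'.1 0) * c1 + (u'.1 0 * v'.1 1 - u'.1 1 * v'.1 0) * c2
  have r2 : s * tripleProduct u v v' + s' * tripleProduct v u' v' = 0 := by
    simp only [tripleProduct]
    linear_combination (v.1 1 * v'.1 2 - v.1 2 * v'.1 1) * c0
      - (v.1 0 * v'.1 2 - v.1 2 * v'.1 0) * c1 + (v.1 0 * v'.1 1 - v.1 1 * v'.1 0) * c2
  have r3 : s' * tripleProduct u v u' + t' * tripleProduct u v v' = 0 := by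
    simp only [tripleProduct]
    linear_combination -(u.1 1 * v.1 2 - u.1 2 * v.1 1) * c0
      + (u.1 0 * v.1 2 - u.1 2 * v.1 0) * c1 - (u.1 0 * v.1 1 - u.1 1 * v.1 0) * c2
  have s0 : 0 < s := by
    refine lt_of_le_of_ne hs fun h0 => ?_
    subst h0
    have ht0 : t = 0 := by simpa [n1] using r1
    have hx : x.1 = 0 := by rw [e, ht0]; simp
    have := mem_sphere_zero_iff_norm.1 x.2
    rw [hx] at this
    simp at this
  have t0 : 0 < t := by
    refine lt_of_le_of_ne ht fun h0 => ?_
    subst h0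
    simp [n2, s0.ne'] at r1
  have s0' : 0 < s' := by
    refine lt_of_le_of_ne hs' fun h0 => ?_
    subst h0
    simp [n3, s0.ne'] at r2
  have t0' : 0 < t' := by
    refine lt_of_le_of_ne ht' fun h0 => ?_
    subst h0
    simp [n4, s0'.ne'] at r3
  have key {p q x y : ℝ} (hp : 0 < p) (hq : 0 < q) (hx : x ≠ 0) (hr : p * x + q * y = 0) :
      y * x < 0 := by
    have h1 : q * (y * x) = -(p * x ^ 2) := by linear_combination x * hr
    have h2 : 0 < p * x ^ 2 := by positivity
    by_contra! h3
    have := mul_nonneg hq.le h3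
    linarith
  exact ⟨key s0 t0 n2 r1, key s0 s0' n3 r2, key s0' t0' n4 r3⟩

theorem GeneralPosition.arcsCross_iff {u v u' v' : Sphere2} (hg : GeneralPosition u v u' v') :
    ArcsCross u v u' v' ↔ CrossingSigns u v u' v' :=
  ⟨fun h => hg.crossingSigns (h.2.mono (Set.inter_subset_inter Set.sdiff_subset Set.sdiff_subset)),
    CrossingSigns.arcsCross⟩

theorem GeneralPosition.segments_inter_iff {u v u' v' : Sphere2}
    (hg : GeneralPosition u v u' v') :
    (geodesicSegment u v ∩ geodesicSegment u' v').Nonempty ↔ CrossingSigns u v u' v' :=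
  ⟨hg.crossingSigns,
    fun h => h.arcsCross.2.mono (Set.inter_subset_inter Set.sdiff_subset Set.sdiff_subset)⟩

section Topology

variable {X : Type*} [TopologicalSpace X] {u v u' v' : X → Sphere2}

theorem isOpen_setOf_generalPosition (hu : Continuous u) (hv : Continuous v) (hu' : Continuous u')
    (hv' : Continuous v') : IsOpen {q | GeneralPosition (u q) (v q) (u' q) (v' q)} :=
  ((hv.tripleProduct hu' hv').isOpen_preimage _ isOpen_compl_singleton).inter <|
    ((hu.tripleProduct hu' hv').isOpen_preimage _ isOpen_compl_singleton).inter <|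
      ((hu.tripleProduct hv hv').isOpen_preimage _ isOpen_compl_singleton).inter
        ((hu.tripleProduct hv hu').isOpen_preimage _ isOpen_compl_singleton)

theorem isOpen_setOf_crossingSigns (hu : Continuous u) (hv : Continuous v) (hu' : Continuous u')
    (hv' : Continuous v') : IsOpen {q | CrossingSigns (u q) (v q) (u' q) (v' q)} :=
  (isOpen_lt ((hv.tripleProduct hu' hv').mul (hu.tripleProduct hu' hv')) continuous_const).inter <|
    (isOpen_lt ((hv.tripleProduct hu' hv').mul (hu.tripleProduct hv hv')) continuous_const).inter
      (isOpen_lt ((hu.tripleProduct hv hv').mul (hu.tripleProduct hv hu')) continuous_const)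

/-- The crossing relation is locally constant on configurations in general position: there it is
given by the signs of continuous nonvanishing functions. -/
theorem GeneralPosition.eventually_arcsCross_iff (hu : Continuous u) (hv : Continuous v)
    (hu' : Continuous u') (hv' : Continuous v') {p : X}
    (hg : GeneralPosition (u p) (v p) (u' p) (v' p)) :
    ∀ᶠ q in 𝓝 p, ArcsCross (u q) (v q) (u' q) (v' q) ↔ ArcsCross (u p) (v p) (u' p) (v' p) := by
  have key {f : X → ℝ} (hf : Continuous f) (h0 : f p ≠ 0) : ∀ᶠ q in 𝓝 p, (f q < 0 ↔ f p < 0) := by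
    rcases lt_or_gt_of_ne h0 with h | h
    · filter_upwards [hf.continuousAt.eventually_lt_const h] with q hq
      exact iff_of_true hq h
    · filter_upwards [hf.continuousAt.eventually_const_lt h] with q hq
      exact iff_of_false hq.le.not_gt h.le.not_gt
  obtain ⟨n1, n2, n3, n4⟩ := id hg
  filter_upwards [(isOpen_setOf_generalPosition hu hv hu' hv').mem_nhds hg,
    key ((hv.tripleProduct hu' hv').mul (hu.tripleProduct hu' hv')) (mul_ne_zero n1 n2),
    key ((hv.tripleProduct hu' hv').mul (hu.tripleProduct hv hv')) (mul_ne_zero n1 n3),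
    key ((hu.tripleProduct hv hv').mul (hu.tripleProduct hv hu')) (mul_ne_zero n3 n4)]
    with q hq k1 k2 k3
  rw [GeneralPosition.arcsCross_iff hq, hg.arcsCross_iff]
  exact and_congr k1 (and_congr k2 k3)

end Topology

/-! ### General position is almost sure -/

theorem Nondegenerate.ae_inner_ne_zero {μ : Measure Sphere2} (hμ : Nondegenerate μ)
    {c : EuclideanSpace ℝ (Fin 3)} (hc : c ≠ 0) :
    ∀ᵐ x : Sphere2 ∂μ, inner ℝ c (x : EuclideanSpace ℝ (Fin 3)) ≠ 0 := by
  have : Fact (Module.finrank ℝ (EuclideanSpace ℝ (Fin 3)) = 2 + 1) := ⟨by simp⟩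
  have h := hμ (Submodule.span ℝ {c})ᗮ (Submodule.finrank_orthogonal_span_singleton hc)
  simpa [ae_iff, Submodule.mem_orthogonal_singleton_iff_inner_right] using h

/-- The cross product of two points, as a vector of `ℝ³`. -/
def crossVec (x y : EuclideanSpace ℝ (Fin 3)) : EuclideanSpace ℝ (Fin 3) :=
  !₂[x 1 * y 2 - x 2 * y 1, x 2 * y 0 - x 0 * y 2, x 0 * y 1 - x 1 * y 0]

theorem tripleProduct_eq_inner (x y z : EuclideanSpace ℝ (Fin 3)) :
    tripleProduct x y z = inner ℝ (crossVec x y) z := by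
  simp [tripleProduct, crossVec, PiLp.inner_apply, Fin.sum_univ_three]
  ring

/-- One nonzero row of the linear map `y ↦ crossVec x y` already confines its kernel to a plane. -/
theorem Nondegenerate.ae_crossVec_ne_zero {μ : Measure Sphere2} (hμ : Nondegenerate μ)
    (x : Sphere2) : ∀ᵐ y : Sphere2 ∂μ, crossVec x y ≠ 0 := by
  by_cases h : x.1 0 = 0 ∧ x.1 1 = 0
  · have h2 : x.1 2 ≠ 0 := by
      intro h2
      have hx := mem_sphere_zero_iff_norm.1 x.2
      have h0 : x.1 = 0 := by
        ext i
        fin_cases i <;> simp [h.1, h.2, h2]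
      rw [h0] at hx
      simp at hx
    have hc : !₂[0, -x.1 2, x.1 1] ≠ (0 : EuclideanSpace ℝ (Fin 3)) := by
      intro h0
      apply h2
      simpa using congrArg (fun y : EuclideanSpace ℝ (Fin 3) => y 1) h0
    filter_upwards [hμ.ae_inner_ne_zero hc] with y hy h0
    apply hy
    have := congrArg (fun y : EuclideanSpace ℝ (Fin 3) => y 0) h0
    simp [crossVec] at this
    simp [PiLp.inner_apply, Fin.sum_univ_three]
    linarith
  · have hc : !₂[-x.1 1, x.1 0, 0] ≠ (0 : EuclideanSpace ℝ (Fin 3)) := by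
      intro h0
      apply h
      constructor
      · simpa using congrArg (fun y : EuclideanSpace ℝ (Fin 3) => y 1) h0
      · simpa using congrArg (fun y : EuclideanSpace ℝ (Fin 3) => y 0) h0
    filter_upwards [hμ.ae_inner_ne_zero hc] with y hy h0
    apply hy
    have := congrArg (fun y : EuclideanSpace ℝ (Fin 3) => y 2) h0
    simp [crossVec] at this
    simp [PiLp.inner_apply, Fin.sum_univ_three]
    linarith

theorem Nondegenerate.ae_tripleProduct_ne_zero {μ : Measure Sphere2} (hμ : Nondegenerate μ)
    {x y : EuclideanSpace ℝ (Fin 3)} (h : crossVec x y ≠ 0) :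
    ∀ᵐ z : Sphere2 ∂μ, tripleProduct x y z ≠ 0 := by
  simpa only [tripleProduct_eq_inner] using hμ.ae_inner_ne_zero h

theorem crossVec_swap (x y : EuclideanSpace ℝ (Fin 3)) : crossVec x y = -crossVec y x := by
  ext i
  fin_cases i <;> simp [crossVec] <;> ring

theorem Nondegenerate.nullSingletonClass {μ : Measure Sphere2} (hμ : Nondegenerate μ) :
    NullSingletonClass μ := by
  refine ⟨fun x => measure_mono_null (fun y hy => ?_) (ae_iff.1 (hμ.ae_crossVec_ne_zero x))⟩
  rw [Set.mem_singleton_iff.1 hy, Set.mem_ofPred_eq, not_not]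
  ext i
  fin_cases i <;> simp [crossVec] <;> ring

/-- Two independent `(μ₁, μ₂)`-random segments are almost surely in general position. -/
theorem ae_generalPosition {μ₁ μ₂ : Measure Sphere2} [IsProbabilityMeasure μ₁]
    [IsProbabilityMeasure μ₂] (hμ₁ : Nondegenerate μ₁) (hμ₂ : Nondegenerate μ₂) :
    ∀ᵐ q ∂((μ₁.prod μ₁).prod (μ₂.prod μ₂)), GeneralPosition q.1.1 q.2.1 q.1.2 q.2.2 := by
  have hm : MeasurableSet {q : (Sphere2 × Sphere2) × (Sphere2 × Sphere2) |
      GeneralPosition q.1.1 q.2.1 q.1.2 q.2.2} :=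
    (isOpen_setOf_generalPosition (by fun_prop) (by fun_prop) (by fun_prop)
      (by fun_prop)).measurableSet
  refine (Measure.ae_prod_iff_ae_ae hm).2 ?_
  have hc : ∀ᵐ p ∂(μ₁.prod μ₁), crossVec p.1 p.2 ≠ 0 := by
    refine (Measure.ae_prod_iff_ae_ae (p := fun p : Sphere2 × Sphere2 => crossVec p.1 p.2 ≠ 0)
      ?_).2 (ae_of_all _ fun x => hμ₁.ae_crossVec_ne_zero x)
    have : Continuous fun p : Sphere2 × Sphere2 => crossVec p.1 p.2 := by
      unfold crossVec
      fun_prop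
    exact (this.isOpen_preimage _ isOpen_compl_singleton).measurableSet
  filter_upwards [hc] with p hp
  refine (Measure.ae_prod_iff_ae_ae (hm.preimage measurable_prodMk_left)).2 ?_
  filter_upwards [hμ₂.ae_crossVec_ne_zero p.1, hμ₂.ae_crossVec_ne_zero p.2,
    hμ₂.ae_tripleProduct_ne_zero hp] with v h1 h2 h3
  rw [crossVec_swap, neg_ne_zero] at h2
  filter_upwards [hμ₂.ae_tripleProduct_ne_zero h2, hμ₂.ae_tripleProduct_ne_zero hp,
    hμ₂.ae_tripleProduct_ne_zero h1] with v' k1 k2 k3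
  refine ⟨k1, k2, k3, ?_⟩
  have : tripleProduct p.1 v p.2 = -tripleProduct p.1 p.2 v := by
    simp only [tripleProduct]; ring
  rw [this]
  exact neg_ne_zero.2 h3

/-! ### Almost sure weak convergence of empirical measures -/

/-- Strong law of large numbers for triangular arrays of bounded random variables. Only rows are
independent, so almost sure convergence needs summable tails, which Hoeffding's inequality gives. -/
theorem ae_tendsto_average_of_bounded {Ω : Type*} [MeasurableSpace Ω] {P : Measure Ω}
    [IsProbabilityMeasure P] {Y : (n : ℕ) → Fin n → Ω → ℝ} {M m : ℝ} (hM : 0 < M)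
    (hY : ∀ n i, AEMeasurable (Y n i) P) (hb : ∀ n i ω, Y n i ω ∈ Set.Icc (-M) M)
    (hm : ∀ n i, ∫ ω, Y n i ω ∂P = m) (hind : ∀ n, iIndepFun (Y n) P) :
    ∀ᵐ ω ∂P, Tendsto (fun n : ℕ => (n : ℝ)⁻¹ * ∑ i, Y n i ω) atTop (𝓝 m) := by
  -- The sub-Gaussian parameter of Hoeffding's lemma for values in `[-M, M]`.
  set c : NNReal := (‖M - -M‖₊ / 2) ^ 2 with hc
  have hcpos : (0 : ℝ) < c := by
    have : (c : ℝ) = M ^ 2 := by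
      rw [hc]
      push_cast
      rw [Real.norm_of_nonneg (by linarith)]
      ring
    rw [this]
    positivity
  have hsub (n : ℕ) (i : Fin n) : HasSubgaussianMGF (fun ω => Y n i ω - m) c P := by
    have := hasSubgaussianMGF_of_mem_Icc (hY n i) (ae_of_all _ (hb n i))
    rwa [hm n i] at this
  have hindp (n : ℕ) : iIndepFun (fun i ω => Y n i ω - m) P :=
    (hind n).comp (fun _ y => y - m) fun _ => by fun_prop
  have hindn (n : ℕ) : iIndepFun (fun i => -fun ω => Y n i ω - m) P :=
    (hind n).comp (fun _ y => -(y - m)) fun _ => by fun_prop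
  have tail (n : ℕ) (ε : ℝ) (hε : 0 < ε) :
      P {ω | n * ε ≤ |∑ i, (Y n i ω - m)|} ≤
        ENNReal.ofReal (2 * Real.exp (n * (-ε ^ 2 / (2 * c)))) := by
    have e : -(n * ε) ^ 2 / (2 * ∑ i : Fin n, (c : ℝ)) = n * (-ε ^ 2 / (2 * c)) := by
      rcases Nat.eq_zero_or_pos n with rfl | hn
      · simp
      · have : (0 : ℝ) < n := by exact_mod_cast hn
        simp only [Finset.sum_const, Finset.card_univ, Fintype.card_fin, nsmul_eq_mul]
        field_simp
    have hp := HasSubgaussianMGF.measure_sum_ge_le_of_iIndepFun (hindp n) (c := fun _ => c)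
      (s := Finset.univ) (fun i _ => hsub n i) (ε := n * ε) (by positivity)
    have hq := HasSubgaussianMGF.measure_sum_ge_le_of_iIndepFun (hindn n) (c := fun _ => c)
      (s := Finset.univ) (fun i _ => (hsub n i).neg) (ε := n * ε) (by positivity)
    rw [NNReal.coe_sum, e] at hp hq
    have hsubset : {ω | n * ε ≤ |∑ i, (Y n i ω - m)|} ⊆
        {ω | n * ε ≤ ∑ i, (Y n i ω - m)} ∪
          {ω | n * ε ≤ ∑ i, (-fun ω => Y n i ω - m) ω} := by
      intro ω hω
      rcases le_abs.1 (Set.mem_ofPred.1 hω) with h | h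
      · exact Or.inl h
      · right
        change (n : ℝ) * ε ≤ ∑ i, -(Y n i ω - m)
        rwa [Finset.sum_neg_distrib]
    refine (measure_mono hsubset).trans ((measure_union_le _ _).trans ?_)
    rw [two_mul, ENNReal.ofReal_add (Real.exp_nonneg _) (Real.exp_nonneg _)]
    refine add_le_add ?_ ?_
    · exact (ENNReal.le_ofReal_iff_toReal_le (measure_ne_top _ _) (Real.exp_nonneg _)).2 hp
    · exact (ENNReal.le_ofReal_iff_toReal_le (measure_ne_top _ _) (Real.exp_nonneg _)).2 hq
  have hae (j : ℕ) : ∀ᵐ ω ∂P, ∀ᶠ n : ℕ in atTop,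
      |∑ i, (Y n i ω - m)| < n * (1 / ((j : ℝ) + 1)) := by
    have hε : (0 : ℝ) < 1 / ((j : ℝ) + 1) := by positivity
    suffices h : ∑' n : ℕ, P {ω | n * (1 / ((j : ℝ) + 1)) ≤ |∑ i, (Y n i ω - m)|} ≠ ⊤ by
      simpa using ae_eventually_notMem h
    refine ne_top_of_le_ne_top ?_ (ENNReal.tsum_le_tsum fun n => tail n _ hε)
    have hneg : -(1 / ((j : ℝ) + 1)) ^ 2 / (2 * c) < 0 :=
      div_neg_of_neg_of_pos (neg_neg_of_pos (by positivity)) (by positivity)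
    exact ((Real.summable_exp_nat_mul_iff.2 hneg).mul_left 2).tsum_ofReal_ne_top
  filter_upwards [ae_all_iff.2 hae] with ω hω
  rw [Metric.tendsto_atTop']
  intro ε hε
  obtain ⟨j, hj⟩ := exists_nat_one_div_lt hε
  obtain ⟨N, hN⟩ := eventually_atTop.1 (hω j)
  refine ⟨N, fun n hn => ?_⟩
  have hn0 : (0 : ℝ) < n := by exact_mod_cast (Nat.zero_le N).trans_lt hn
  have h := hN n hn.le
  have e : (n : ℝ)⁻¹ * ∑ i, Y n i ω - m = (n : ℝ)⁻¹ * ∑ i, (Y n i ω - m) := by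
    rw [Finset.sum_sub_distrib]
    simp only [Finset.sum_const, Finset.card_univ, Fintype.card_fin, nsmul_eq_mul]
    field_simp
  rw [Real.dist_eq, e, abs_mul, abs_of_pos (inv_pos.2 hn0), inv_mul_lt_iff₀ hn0]
  exact h.trans (by gcongr)

/-- The empirical measure of a nonempty finite family of points. -/
noncomputable def empiricalMeasure {E ι : Type*} [MeasurableSpace E] [Fintype ι] [Nonempty ι]
    [MeasurableSpace ι] [DiscreteMeasurableSpace ι] (x : ι → E) : ProbabilityMeasure E :=
  ⟨(uniformOn Set.univ).map x,
    have := isProbabilityMeasure_uniformOn (s := (Set.univ : Set ι)) Set.finite_univ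
      Set.univ_nonempty
    Measure.isProbabilityMeasure_map Measurable.of_discrete.aemeasurable⟩

theorem toMeasure_empiricalMeasure {E ι : Type*} [MeasurableSpace E] [Fintype ι] [Nonempty ι]
    [MeasurableSpace ι] [DiscreteMeasurableSpace ι] (x : ι → E) :
    (empiricalMeasure x : Measure E) = (uniformOn Set.univ).map x := rfl

theorem uniformOn_univ_real_singleton {ι : Type*} [Fintype ι]
    [MeasurableSpace ι] [DiscreteMeasurableSpace ι] (i : ι) :
    (uniformOn (Set.univ : Set ι)).real {i} = (Fintype.card ι : ℝ)⁻¹ := by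
  classical
  rw [Measure.real, uniformOn_univ]
  simp

theorem integral_empiricalMeasure {E ι : Type*} [TopologicalSpace E] [MeasurableSpace E]
    [OpensMeasurableSpace E] [Fintype ι] [Nonempty ι] [MeasurableSpace ι]
    [DiscreteMeasurableSpace ι] (x : ι → E) {f : E → ℝ} (hf : Continuous f) :
    ∫ y, f y ∂(empiricalMeasure x : Measure E) = (Fintype.card ι : ℝ)⁻¹ * ∑ i, f (x i) := by
  have := isProbabilityMeasure_uniformOn (s := (Set.univ : Set ι)) Set.finite_univ Set.univ_nonempty
  rw [toMeasure_empiricalMeasure, integral_map Measurable.of_discrete.aemeasurable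
    hf.measurable.aestronglyMeasurable, integral_fintype Integrable.of_finite]
  simp [uniformOn_univ_real_singleton, Finset.mul_sum]

/-- Almost surely, the empirical measures of the rows of a triangular array with law `μ` and
independent rows converge weakly to `μ`. By separability of `C(E, ℝ)`, countably many test
functions suffice. -/
theorem ae_tendsto_empiricalMeasure {E : Type*} [MetricSpace E] [CompactSpace E]
    [MeasurableSpace E] [BorelSpace E] {Ω : Type*} [MeasurableSpace Ω] {P : Measure Ω}
    [IsProbabilityMeasure P] {μ : ProbabilityMeasure E} {x : (n : ℕ) → Fin n → Ω → E}
    (hlaw : ∀ n i, HasLaw (x n i) μ P) (hind : ∀ n, iIndepFun (x n) P) :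
    ∀ᵐ ω ∂P, Tendsto (fun n => empiricalMeasure fun i => x (n + 1) i ω) atTop (𝓝 μ) := by
  have test (f : C(E, ℝ)) : ∀ᵐ ω ∂P,
      Tendsto (fun n : ℕ => (n : ℝ)⁻¹ * ∑ i, f (x n i ω)) atTop (𝓝 (∫ y, f y ∂(μ : Measure E))) := by
    refine ae_tendsto_average_of_bounded (Y := fun n i ω => f (x n i ω)) (M := ‖f‖ + 1)
      (by positivity) (fun n i => f.measurable.comp_aemeasurable (hlaw n i).aemeasurable)
      (fun n i ω => ?_) (fun n i => ?_)
      (fun n => (hind n).comp (fun _ => f) fun _ => f.measurable)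
    · have := f.norm_coe_le_norm (x n i ω)
      rw [Real.norm_eq_abs] at this
      exact abs_le.1 (this.trans (by linarith))
    · rw [← (hlaw n i).map_eq, integral_map (hlaw n i).aemeasurable
        f.continuous.measurable.aestronglyMeasurable]
  filter_upwards [ae_all_iff.2 fun k => test (TopologicalSpace.denseSeq C(E, ℝ) k)] with ω hω
  rw [ProbabilityMeasure.tendsto_iff_forall_integral_tendsto]
  intro g
  rw [Metric.tendsto_atTop]
  intro ε hε
  obtain ⟨k, hk⟩ := (TopologicalSpace.denseRange_denseSeq C(E, ℝ)).exists_dist_lt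
    g.toContinuousMap (ε := ε / 3) (by linarith)
  set f := TopologicalSpace.denseSeq C(E, ℝ) k
  have hclose (ν : ProbabilityMeasure E) :
      |∫ y, g y ∂(ν : Measure E) - ∫ y, f y ∂(ν : Measure E)| ≤ ε / 3 := by
    rw [← integral_sub (g.integrable _) (f.continuous.integrable_of_hasCompactSupport
      (HasCompactSupport.of_compactSpace f)), ← Real.norm_eq_abs]
    refine (norm_integral_le_of_norm_le_const (ae_of_all _ fun y => ?_)).trans_eq
      (by simp : ε / 3 * (ν : Measure E).real Set.univ = ε / 3)
    rw [← dist_eq_norm]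
    exact (ContinuousMap.dist_apply_le_dist (f := g.toContinuousMap) (g := f) y).trans hk.le
  obtain ⟨N, hN⟩ := Metric.tendsto_atTop.1 ((tendsto_add_atTop_iff_nat 1).2 (hω k)) (ε / 3)
    (by linarith)
  refine ⟨N, fun n hn => ?_⟩
  have h1 := hN n hn
  have h2 := hclose (empiricalMeasure fun i => x (n + 1) i ω)
  have h3 := hclose μ
  have e := integral_empiricalMeasure (fun i => x (n + 1) i ω) f.continuous
  rw [Fintype.card_fin] at e
  rw [← e] at h1
  rw [Real.dist_eq] at h1 ⊢
  rw [abs_lt] at h1 ⊢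
  rw [abs_le] at h2 h3
  constructor <;> linarith

/-! ### Crossing configurations -/

/-- The configurations of segments indexed by `V` for which every edge of `H` joins two crossing
arcs. -/
def crossingConfigs {V : Type*} (H : SimpleGraph V) : Set ((V → Sphere2) × (V → Sphere2)) :=
  {p | ∀ i j, H.Adj i j → ArcsCross (p.1 i) (p.2 i) (p.1 j) (p.2 j)}

theorem measurePreserving_eval_pair {V E : Type*} [Fintype V] [MeasurableSpace E] (μ : Measure E)
    [IsProbabilityMeasure μ] {i j : V} (hij : i ≠ j) :
    MeasurePreserving (fun x : V → E => (x i, x j)) (Measure.pi fun _ => μ) (μ.prod μ) := by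
  refine ⟨by fun_prop, ?_⟩
  have h := (iIndepFun_pi (μ := fun _ : V => μ) (X := fun _ y => y)
    (fun _ => by fun_prop)).indepFun hij
  rw [(indepFun_iff_map_prod_eq_prod_map_map (measurable_pi_apply i).aemeasurable
    (measurable_pi_apply j).aemeasurable).1 h]
  have e (l : V) : (Measure.pi fun _ : V => μ).map (fun x => x l) = μ :=
    (measurePreserving_eval (fun _ : V => μ) l).map_eq
  rw [e, e]

theorem measurePreserving_eval_pair_prod {V E F : Type*} [Fintype V] [MeasurableSpace E]
    [MeasurableSpace F] (μ : Measure E) (ν : Measure F) [IsProbabilityMeasure μ]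
    [IsProbabilityMeasure ν] {i j : V} (hij : i ≠ j) :
    MeasurePreserving (fun p : (V → E) × (V → F) => ((p.1 i, p.1 j), (p.2 i, p.2 j)))
      ((Measure.pi fun _ => μ).prod (Measure.pi fun _ => ν)) ((μ.prod μ).prod (ν.prod ν)) :=
  (measurePreserving_eval_pair μ hij).prod (measurePreserving_eval_pair ν hij)

section Configs

variable {V : Type*} [Fintype V] {μ₁ μ₂ : Measure Sphere2} [IsProbabilityMeasure μ₁]
  [IsProbabilityMeasure μ₂] (H : SimpleGraph V)

theorem ae_forall_generalPosition (hμ₁ : Nondegenerate μ₁) (hμ₂ : Nondegenerate μ₂) :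
    ∀ᵐ p ∂((Measure.pi fun _ : V => μ₁).prod (Measure.pi fun _ : V => μ₂)),
      ∀ i j, i ≠ j → GeneralPosition (p.1 i) (p.2 i) (p.1 j) (p.2 j) := by
  refine ae_all_iff.2 fun i => ae_all_iff.2 fun j => ?_
  by_cases hij : i = j
  · exact ae_of_all _ fun p h => absurd hij h
  have h := (measurePreserving_eval_pair_prod μ₁ μ₂ hij).quasiMeasurePreserving.ae
    (ae_generalPosition hμ₁ hμ₂)
  filter_upwards [h] with p hp _ using hp

/-- Membership in `crossingConfigs H` is locally constant at every configuration in general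
position. -/
theorem measure_frontier_crossingConfigs (hμ₁ : Nondegenerate μ₁) (hμ₂ : Nondegenerate μ₂) :
    ((Measure.pi fun _ : V => μ₁).prod (Measure.pi fun _ : V => μ₂))
      (frontier (crossingConfigs H)) = 0 := by
  refine measure_mono_null (fun p hp => Set.mem_ofPred.2 fun hg => ?_)
    (ae_iff.1 (ae_forall_generalPosition hμ₁ hμ₂))
  have hloc : ∀ᶠ q in 𝓝 p, (q ∈ crossingConfigs H ↔ p ∈ crossingConfigs H) := by
    have : ∀ᶠ q in 𝓝 p, ∀ i j, i ≠ j → (ArcsCross (q.1 i) (q.2 i) (q.1 j) (q.2 j) ↔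
        ArcsCross (p.1 i) (p.2 i) (p.1 j) (p.2 j)) := by
      refine eventually_all.2 fun i => eventually_all.2 fun j => ?_
      by_cases hij : i = j
      · exact Eventually.of_forall fun q h => absurd hij h
      filter_upwards [(hg i j hij).eventually_arcsCross_iff (u := fun q => q.1 i)
        (v := fun q => q.2 i) (u' := fun q => q.1 j) (v' := fun q => q.2 j) (by fun_prop)
        (by fun_prop) (by fun_prop) (by fun_prop)] with q hq _ using hq
    filter_upwards [this] with q hq
    exact forall₂_congr fun i j => imp_congr_right fun h => hq i j h.ne
  by_cases hpC : p ∈ crossingConfigs H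
  · refine hp.2 (mem_interior_iff_mem_nhds.2 ?_)
    filter_upwards [hloc] with q hq using hq.2 hpC
  · refine mem_closure_iff_frequently.1 hp.1 ?_
    filter_upwards [hloc] with q hq using fun h => hpC (hq.1 h)

theorem segmentProb_eq_crossingConfigs (hμ₁ : Nondegenerate μ₁) (hμ₂ : Nondegenerate μ₂) :
    segmentProb μ₁ μ₂ H =
      ((Measure.pi fun _ : V => μ₁).prod (Measure.pi fun _ : V => μ₂)).real
        (crossingConfigs H) := by
  refine measureReal_congr ?_
  filter_upwards [ae_forall_generalPosition hμ₁ hμ₂] with p hp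
  refine propext (forall₂_congr fun i j => imp_congr_right fun h => ?_)
  have hg := hp i j h.ne
  rw [hg.arcsCross_iff, ← hg.segments_inter_iff]
  exact and_iff_right h.ne

/-! ### The limit graphon -/

/-- The set of configurations that satisfy the sign pattern along every edge of `H`. Unlike
`crossingConfigs H`, which it equals almost everywhere, it is visibly measurable. -/
def signConfigs {V : Type*} (H : SimpleGraph V) : Set ((V → Sphere2) × (V → Sphere2)) :=
  {p | ∀ i j, H.Adj i j → CrossingSigns (p.1 i) (p.2 i) (p.1 j) (p.2 j)}

theorem measurableSet_signConfigs : MeasurableSet (signConfigs H) := by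
  have : signConfigs H = ⋂ i, ⋂ j, ⋂ _ : H.Adj i j,
      {p | CrossingSigns (p.1 i) (p.2 i) (p.1 j) (p.2 j)} := by
    ext p
    simp [signConfigs]
  rw [this]
  exact MeasurableSet.iInter fun i => MeasurableSet.iInter fun j => MeasurableSet.iInter fun _ =>
    (isOpen_setOf_crossingSigns (by fun_prop) (by fun_prop) (by fun_prop)
      (by fun_prop)).measurableSet

theorem segmentProb_eq_signConfigs (hμ₁ : Nondegenerate μ₁) (hμ₂ : Nondegenerate μ₂) :
    segmentProb μ₁ μ₂ H =
      ((Measure.pi fun _ : V => μ₁).prod (Measure.pi fun _ : V => μ₂)).real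
        (signConfigs H) := by
  rw [segmentProb_eq_crossingConfigs H hμ₁ hμ₂]
  refine measureReal_congr ?_
  filter_upwards [ae_forall_generalPosition hμ₁ hμ₂] with p hp
  exact propext (forall₂_congr fun i j => imp_congr_right fun h => (hp i j h.ne).arcsCross_iff)

open Classical in
/-- The graphon of the crossing relation, transported to `[0, 1]` by a map `φ` that assigns a
segment to every parameter. -/
noncomputable def crossingGraphon (φ : unitInterval → Sphere2 × Sphere2) (hφ : Measurable φ) :
    Graphon where
  toFun x y := if CrossingSigns (φ x).1 (φ x).2 (φ y).1 (φ y).2 then 1 else 0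
  measurable' := by
    have hs : MeasurableSet {q : (Sphere2 × Sphere2) × (Sphere2 × Sphere2) |
        CrossingSigns q.1.1 q.1.2 q.2.1 q.2.2} :=
      (isOpen_setOf_crossingSigns (by fun_prop) (by fun_prop) (by fun_prop)
        (by fun_prop)).measurableSet
    have hm : Measurable fun z : unitInterval × unitInterval => (φ z.1, φ z.2) := by fun_prop
    exact Measurable.ite (hm hs) measurable_const measurable_const
  symm' x y := if_congr ⟨crossingSigns_symm, crossingSigns_symm⟩ rfl rfl
  nonneg' x y := by split_ifs <;> norm_num
  le_one' x y := by split_ifs <;> norm_num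

theorem density_crossingGraphon {φ : unitInterval → Sphere2 × Sphere2} (hφ : Measurable φ)
    (hmap : (volume : Measure unitInterval).map φ = μ₁.prod μ₂) :
    (crossingGraphon φ hφ).density H =
      ((Measure.pi fun _ : V => μ₁).prod (Measure.pi fun _ : V => μ₂)).real (signConfigs H) := by
  classical
  have h1 : MeasurePreserving (fun (x : V → unitInterval) i => φ (x i)) volume
      (Measure.pi fun _ => μ₁.prod μ₂) :=
    measurePreserving_pi (fun _ => volume) _ fun _ => ⟨hφ, hmap⟩
  have h2 := (measurePreserving_arrowProdEquivProdArrow Sphere2 Sphere2 V (fun _ => μ₁)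
    fun _ => μ₂).comp h1
  have hm := measurableSet_signConfigs H
  rw [← h2.measureReal_preimage hm.nullMeasurableSet, ← integral_indicator_one (h2.measurable hm)]
  unfold Graphon.density
  refine integral_congr_ae (ae_of_all _ fun x => ?_)
  dsimp only
  have hmem : x ∈ (MeasurableEquiv.arrowProdEquivProdArrow Sphere2 Sphere2 V ∘
      fun x i => φ (x i)) ⁻¹' signConfigs H ↔ ∀ i j, H.Adj i j →
        CrossingSigns (φ (x i)).1 (φ (x i)).2 (φ (x j)).1 (φ (x j)).2 := Iff.rfl
  by_cases hx : ∀ i j, H.Adj i j →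
      CrossingSigns (φ (x i)).1 (φ (x i)).2 (φ (x j)).1 (φ (x j)).2
  · rw [Set.indicator_of_mem (hmem.2 hx), Pi.one_apply]
    refine Finset.prod_eq_one fun e he => ?_
    induction e with | _ i j =>
    rw [SimpleGraph.mem_edgeFinset, SimpleGraph.mem_edgeSet] at he
    exact if_pos (hx i j he)
  · rw [Set.indicator_of_notMem (mt hmem.1 hx)]
    push Not at hx
    obtain ⟨i, j, hij, hn⟩ := hx
    refine Finset.prod_eq_zero (i := s(i, j)) ?_ (if_neg hn)
    rw [SimpleGraph.mem_edgeFinset, SimpleGraph.mem_edgeSet]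
    exact hij

end Configs

/-! ### Homomorphism densities of crossing graphs -/

/-- Push-forward along a map with finite domain is evaluated by preimages on all sets, measurable or
not, because the range is a finite set of full measure. -/
theorem map_apply_of_finite {α β : Type*} [Finite α] [MeasurableSpace α]
    [DiscreteMeasurableSpace α] [MeasurableSpace β] [MeasurableSingletonClass β] (ν : Measure α)
    (f : α → β) (A : Set β) : ν.map f A = ν (f ⁻¹' A) := by
  have hf : Measurable f := Measurable.of_discrete
  refine le_antisymm ?_ (Measure.le_map_apply hf.aemeasurable A)
  have hr : (ν.map f) (Set.range f)ᶜ = 0 := by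
    rw [Measure.map_apply hf (Set.finite_range f).measurableSet.compl]
    simp
  calc ν.map f A ≤ ν.map f ((A ∩ Set.range f) ∪ (Set.range f)ᶜ) := by
        refine measure_mono fun y hy => ?_
        by_cases h : y ∈ Set.range f
        exacts [Or.inl ⟨hy, h⟩, Or.inr h]
    _ ≤ ν.map f (A ∩ Set.range f) + 0 := hr ▸ measure_union_le _ _
    _ = ν (f ⁻¹' (A ∩ Set.range f)) := by
        rw [add_zero, Measure.map_apply hf ((Set.finite_range f).inter_of_right A).measurableSet]
    _ ≤ ν (f ⁻¹' A) := measure_mono fun y hy => hy.1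

/-- Under the product of powers of empirical measures, the measure of an arbitrary set `A` of
configurations is the proportion of the index maps that land in `A`. Measurability of `A` is not
needed, because the measure is supported on a finite set. -/
theorem empiricalMeasure_pi_prod_real {V ι E F : Type*} [Fintype V] [Fintype ι] [Nonempty ι]
    [MeasurableSpace ι] [DiscreteMeasurableSpace ι] [MeasurableSpace E]
    [MeasurableSingletonClass E] [MeasurableSpace F] [MeasurableSingletonClass F]
    (x : ι → E) (y : ι → F) (A : Set ((V → E) × (V → F))) :
    ((Measure.pi fun _ : V => (empiricalMeasure x : Measure E)).prod
        (Measure.pi fun _ : V => (empiricalMeasure y : Measure F))).real A =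
      Nat.card {q : (V → ι) × (V → ι) // (x ∘ q.1, y ∘ q.2) ∈ A} /
        (Nat.card (ι × ι) : ℝ) ^ Nat.card V := by
  classical
  set U : Measure ι := uniformOn Set.univ
  have hU : IsProbabilityMeasure U :=
    isProbabilityMeasure_uniformOn Set.finite_univ Set.univ_nonempty
  have hmap : ((Measure.pi fun _ : V => (empiricalMeasure x : Measure E)).prod
      (Measure.pi fun _ : V => (empiricalMeasure y : Measure F))) =
      ((Measure.pi fun _ : V => U).prod (Measure.pi fun _ : V => U)).map
        fun q => (x ∘ q.1, y ∘ q.2) := by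
    have hx : IsProbabilityMeasure (U.map x) :=
      Measure.isProbabilityMeasure_map Measurable.of_discrete.aemeasurable
    have hy : IsProbabilityMeasure (U.map y) :=
      Measure.isProbabilityMeasure_map Measurable.of_discrete.aemeasurable
    simp only [toMeasure_empiricalMeasure]
    rw [← Measure.pi_map_pi (fun _ => Measurable.of_discrete.aemeasurable),
      ← Measure.pi_map_pi (fun _ => Measurable.of_discrete.aemeasurable),
      Measure.map_prod_map _ _ Measurable.of_discrete Measurable.of_discrete]
    rfl
  have hsing (q : (V → ι) × (V → ι)) :
      ((Measure.pi fun _ : V => U).prod (Measure.pi fun _ : V => U)).real {q} =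
        ((Nat.card (ι × ι) : ℝ) ^ Nat.card V)⁻¹ := by
    have h1 (r : V → ι) : (Measure.pi fun _ : V => U).real {r} =
        ((Fintype.card ι : ℝ) ^ Fintype.card V)⁻¹ := by
      have e (i : ι) : (U {i}).toReal = (Fintype.card ι : ℝ)⁻¹ := uniformOn_univ_real_singleton i
      simp [measureReal_def, Measure.pi_singleton, ENNReal.toReal_prod, e]
    rw [← Set.singleton_prod_singleton, measureReal_prod_prod, h1, h1]
    simp only [Nat.card_eq_fintype_card, Fintype.card_prod, Nat.cast_mul, mul_pow, mul_inv]
  rw [hmap, measureReal_def, map_apply_of_finite, ← measureReal_def]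
  set B : Set ((V → ι) × (V → ι)) := (fun q => (x ∘ q.1, y ∘ q.2)) ⁻¹' A
  rw [← Set.coe_toFinset B, ← sum_measureReal_singleton, Finset.sum_congr rfl fun q _ => hsing q,
    Finset.sum_const, nsmul_eq_mul, div_eq_mul_inv, ← Nat.card_eq_card_toFinset]
  rfl

/-- For injective `a` and `b` the homomorphism density of the crossing graph is the probability,
under the empirical measures of `a` and `b`, of the crossing configurations. -/
theorem homDensity_crossingGraph {V : Type*} [Fintype V] (H : SimpleGraph V) {n : ℕ}
    {a b : Fin (n + 1) → Sphere2} (ha : Function.Injective a) (hb : Function.Injective b) :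
    homDensity H (crossingGraph a b) =
      ((Measure.pi fun _ : V => (empiricalMeasure a : Measure Sphere2)).prod
        (Measure.pi fun _ : V => (empiricalMeasure b : Measure Sphere2))).real
          (crossingConfigs H) := by
  rw [empiricalMeasure_pi_prod_real, homDensity]
  congr 2
  have hadj (e f : Fin (n + 1) × Fin (n + 1)) :
      (crossingGraph a b).Adj e f ↔ ArcsCross (a e.1) (b e.2) (a f.1) (b f.2) := by
    refine and_congr_left fun _ => not_congr ?_
    simp [Prod.ext_iff, ha.eq_iff, hb.eq_iff]
  refine Nat.card_congr
    { toFun := fun g => ⟨(fun v => (g v).1, fun v => (g v).2), fun i j h =>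
        (hadj _ _).1 (g.map_adj h)⟩
      invFun := fun q => ⟨fun v => (q.1.1 v, q.1.2 v), fun {i j} h => (hadj _ _).2 (q.2 i j h)⟩
      left_inv := fun g => rfl
      right_inv := fun q => rfl }

/-- Independent points with an atomless law are almost surely distinct. -/
theorem ae_injective_of_iIndepFun {ι E Ω : Type*} [Countable ι] [MeasurableSpace E]
    [MeasurableEq E] {μ : Measure E} [IsProbabilityMeasure μ] [NullSingletonClass μ]
    [MeasurableSpace Ω] {P : Measure Ω} [IsProbabilityMeasure P] {x : ι → Ω → E}
    (hlaw : ∀ i, HasLaw (x i) μ P) (hind : iIndepFun x P) :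
    ∀ᵐ ω ∂P, Function.Injective fun i => x i ω := by
  have key : ∀ᵐ ω ∂P, ∀ i j, i ≠ j → x i ω ≠ x j ω := by
    refine ae_all_iff.2 fun i => ae_all_iff.2 fun j => ?_
    by_cases hij : i = j
    · exact ae_of_all _ fun ω h => absurd hij h
    have hmap := (indepFun_iff_map_prod_eq_prod_map_map (hlaw i).aemeasurable
      (hlaw j).aemeasurable).1 (hind.indepFun hij)
    rw [(hlaw i).map_eq, (hlaw j).map_eq] at hmap
    have hd : ∀ᵐ p ∂(μ.prod μ), p.1 ≠ p.2 := by
      refine (Measure.ae_prod_iff_ae_ae (p := fun p : E × E => p.1 ≠ p.2)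
        (measurableSet_eq_fun measurable_fst measurable_snd).compl).2 (ae_of_all _ fun y => ?_)
      filter_upwards [compl_mem_ae_iff.2 (measure_singleton (μ := μ) y)] with z hz h
      exact hz h.symm
    rw [← hmap] at hd
    filter_upwards [ae_of_ae_map
      ((hlaw i).aemeasurable.prodMk (hlaw j).aemeasurable) hd] with ω hω _ using hω
  filter_upwards [key] with ω hω i j h
  by_contra hij
  exact hω i j hij h

/-! ### Convergence of the crossing graphs -/

theorem theorem2 (μ₁ μ₂ : Measure Sphere2) [IsProbabilityMeasure μ₁] [IsProbabilityMeasure μ₂]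
    (hμ₁ : Nondegenerate μ₁) (hμ₂ : Nondegenerate μ₂) :
    ∃ W : Graphon,
      (∀ (k : ℕ) (H : SimpleGraph (Fin k)), W.density H = segmentProb μ₁ μ₂ H) ∧
      ∀ {Ω : Type*} [MeasurableSpace Ω] (P : Measure Ω) [IsProbabilityMeasure P]
        (a b : (n : ℕ) → Fin n → Ω → Sphere2),
        IsRandomDrawingSeq P μ₁ μ₂ a b →
        ∀ᵐ ω ∂P,
          ConvergentGraphSeq (fun n => crossingGraph (fun i => a n i ω) (fun j => b n j ω)) ∧
          IsGraphonLimit (fun n => crossingGraph (fun i => a n i ω) (fun j => b n j ω)) W := by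
  have : Nonempty Sphere2 := nonempty_of_isProbabilityMeasure μ₁
  obtain ⟨φ, hφ, hmap⟩ := Measure.exists_measurable_map_eq (μ₁.prod μ₂)
  have hW (k : ℕ) (H : SimpleGraph (Fin k)) :
      (crossingGraphon φ hφ).density H = segmentProb μ₁ μ₂ H := by
    rw [density_crossingGraphon H hφ hmap, segmentProb_eq_signConfigs H hμ₁ hμ₂]
  refine ⟨crossingGraphon φ hφ, hW, ?_⟩
  intro Ω _ P _ a b hab
  have := hμ₁.nullSingletonClass
  have := hμ₂.nullSingletonClass
  have ia (n : ℕ) : iIndepFun (a n) P := iIndepFun.precomp (g := Sum.inl) Sum.inl_injective (hab.indep n)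
  have ib (n : ℕ) : iIndepFun (b n) P := iIndepFun.precomp (g := Sum.inr) Sum.inr_injective (hab.indep n)
  filter_upwards [ae_all_iff.2 fun n => ae_injective_of_iIndepFun (hab.law_left n) (ia n),
    ae_all_iff.2 fun n => ae_injective_of_iIndepFun (hab.law_right n) (ib n),
    ae_tendsto_empiricalMeasure (μ := ⟨μ₁, inferInstance⟩) hab.law_left ia,
    ae_tendsto_empiricalMeasure (μ := ⟨μ₂, inferInstance⟩) hab.law_right ib]
    with ω ja jb ta tb
  suffices h : IsGraphonLimit (fun n => crossingGraph (fun i => a n i ω) (fun j => b n j ω))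
      (crossingGraphon φ hφ) from ⟨fun k H => ⟨_, h k H⟩, h⟩
  intro k H
  rw [hW, segmentProb_eq_crossingConfigs H hμ₁ hμ₂, ← tendsto_add_atTop_iff_nat 1]
  -- Weak convergence passes to finite powers and products of the empirical measures.
  have hpow {ν : ℕ → ProbabilityMeasure Sphere2} {μ : ProbabilityMeasure Sphere2}
      (h : Tendsto ν atTop (𝓝 μ)) : Tendsto (fun n => ProbabilityMeasure.pi fun _ : Fin k => ν n)
        atTop (𝓝 (ProbabilityMeasure.pi fun _ => μ)) :=
    (ProbabilityMeasure.continuous_pi.tendsto _).comp (tendsto_pi_nhds.2 fun _ => h)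
  have hprod := (ProbabilityMeasure.continuous_prod.tendsto _).comp
    ((hpow ta).prodMk_nhds (hpow tb))
  have hlim := (ENNReal.tendsto_toReal (measure_ne_top _ _)).comp
    (ProbabilityMeasure.tendsto_measure_of_null_frontier_of_tendsto' hprod
      (measure_frontier_crossingConfigs (μ₁ := μ₁) (μ₂ := μ₂) H hμ₁ hμ₂))
  refine hlim.congr fun n => ?_
  exact (homDensity_crossingGraph H (ja (n + 1)) (jb (n + 1))).symm
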